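/- Let $\mu_q:\{0,1\}^*\to \mathrm{GL}_2(\mathbb{Z}[q^{\pm1}])$ be the monoid homomorphism defined by \[ \mu_q(0)=R_q^2S_qR_q=\begin{pmatrix} q+q^2 & 1\\ q & 1\end{pmatrix},\qquad \mu_q(1)=R_q^3S_qR_q^2S_qR_q=\begin{pmatrix} q+2q^2+q^3+q^4 & 1+q\\ q+q^2 & 1\end{pmatrix}, \] where $R_q=\begin{pmatrix} q&1\\0&1\end{pmatrix}$ and $S_q=\begin{pmatrix}0&-q^{-1}\\1&0\end{pmatrix}$, and let $\mu_q(w)_{12}$ denote the entry above the diagonal of $\mu_q(w)$. For a biinfinite sequence $s\in\{0,1\}^{\mathbb{Z}}$, let $\mathcal{L}(s)=\{s_ks_{k+1}\cdots s_{k+n-1} : k\in\mathbb{Z},\ n\ge 0\}$ be its language, i.e. the set of its finite factors (including the empty word). The sequence $s$ is balanced if for every positive integer $n$, all words $u,v\in\mathcal{L}(s)$ of length $n$ and every letter $a\in\{0,1\}$, the numbers of occurrences of $a$ in $u$ and in $v$ differ by at most $1$. For words $u,v\in\{0,1\}^*$ write $u<_{radix}v$ if $|u|<|v|$, or $|u|=|v|$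 and $u$ is strictly smaller than $v$ in the lexicographic order with $0<1$. For $f,g\in\mathbb{Z}[q]$ write $f\prec g$ if $f\ne g$ and $g-f\in\mathbb{Z}_{\ge0}[q]$. Theorem. Let $s\in\{0,1\}^{\mathbb{Z}}$ be a balanced sequence and let $u,v\in\mathcal{L}(s)$. If $u<_{radix}v$, then $\mu_q(u)_{12}$ and $\mu_q(v)_{12}$ belong to $\mathbb{Z}[q]$ and $\mu_q(u)_{12}\prec\mu_q(v)_{12}$; that is, $\mu_q(v)_{12}-\mu_q(u)_{12}$ is a nonzero polynomial in the indeterminate $q$ with nonnegative integer coefficients. -/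

import Mathlib

/-!
Words over the alphabet `{0, 1}` are lists over `Fin 2`; biinfinite sequences over an alphabet `α`
are functions `ℤ → α`; the indeterminate `q` is `T 1` in the ring `ℤ[T;T⁻¹]` of Laurent polynomials.
-/

namespace QMarkoff

open scoped LaurentPolynomial MatrixGroups

/-- The language of a biinfinite sequence: the set of its finite factors
`s k, s (k+1), …, s (k+n-1)`, including the empty word. -/
def language {α : Type*} (s : ℤ → α) : Set (List α) :=
  {w | ∃ (k : ℤ) (n : ℕ), w = List.ofFn (fun i : Fin n => s (k + (i : ℕ)))}

/-- A biinfinite sequence is balanced if for every positive `n` and all factors `u`, `v` of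
length `n`, the numbers of occurrences of any given letter in `u` and `v` differ by at most 1. -/
def IsBalanced {α : Type*} [DecidableEq α] (s : ℤ → α) : Prop :=
  ∀ n : ℕ, 0 < n → ∀ u ∈ language s, ∀ v ∈ language s, u.length = n → v.length = n →
    ∀ a : α, |(u.count a : ℤ) - (v.count a : ℤ)| ≤ 1

/-- The radix order on words: first by length, then lexicographically (with `0 < 1`); `<` on lists
is the lexicographic order. -/
def RadixLT (u v : List (Fin 2)) : Prop :=
  u.length < v.length ∨ (u.length = v.length ∧ u < v)

theorem T_one_mul : (LaurentPolynomial.T 1 * LaurentPolynomial.T (-1) : ℤ[T;T⁻¹]) = 1 := by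
  rw [← LaurentPolynomial.T_add, add_neg_cancel, LaurentPolynomial.T_zero]

theorem T_neg_one_mul : (LaurentPolynomial.T (-1) * LaurentPolynomial.T 1 : ℤ[T;T⁻¹]) = 1 := by
  rw [← LaurentPolynomial.T_add, neg_add_cancel, LaurentPolynomial.T_zero]

/-- The matrix `R_q = (q 1; 0 1)`. -/
noncomputable def Rq : GL (Fin 2) ℤ[T;T⁻¹] where
  val := !![LaurentPolynomial.T 1, 1; 0, 1]
  inv := !![LaurentPolynomial.T (-1), -LaurentPolynomial.T (-1); 0, 1]
  val_inv := by
    rw [Matrix.mul_fin_two, Matrix.one_fin_two]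
    simp only [mul_neg, T_one_mul, mul_one, mul_zero, zero_mul, add_zero,
      zero_add, neg_zero, neg_add_cancel]
  inv_val := by
    rw [Matrix.mul_fin_two, Matrix.one_fin_two]
    simp only [T_neg_one_mul, mul_one, mul_zero, zero_mul,
      add_zero, zero_add, add_neg_cancel]

/-- The matrix `S_q = (0 -q⁻¹; 1 0)`. -/
noncomputable def Sq : GL (Fin 2) ℤ[T;T⁻¹] where
  val := !![0, -LaurentPolynomial.T (-1); 1, 0]
  inv := !![0, 1; -LaurentPolynomial.T 1, 0]
  val_inv := by
    rw [Matrix.mul_fin_two, Matrix.one_fin_two]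
    simp only [mul_neg, neg_mul, neg_neg, T_neg_one_mul, mul_one, mul_zero, zero_mul,
      add_zero, zero_add, neg_zero]
  inv_val := by
    rw [Matrix.mul_fin_two, Matrix.one_fin_two]
    simp only [mul_neg, neg_mul, neg_neg, T_one_mul, mul_one, mul_zero, zero_mul,
      add_zero, zero_add, neg_zero]

/-- The monoid homomorphism `μ_q : {0,1}* → GL₂(ℤ[q^{±1}])` with
`μ_q(0) = R_q² S_q R_q = (q + q², 1; q, 1)` and
`μ_q(1) = R_q³ S_q R_q² S_q R_q = (q + 2q² + q³ + q⁴, 1 + q; q + q², 1)`. -/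
noncomputable def muq : FreeMonoid (Fin 2) →* GL (Fin 2) ℤ[T;T⁻¹] :=
  FreeMonoid.lift ![Rq ^ 2 * Sq * Rq, Rq ^ 3 * Sq * Rq ^ 2 * Sq * Rq]

/-- The entry above the diagonal of `μ_q(w)`, a priori a Laurent polynomial. -/
noncomputable def muq12 (w : List (Fin 2)) : ℤ[T;T⁻¹] :=
  (muq (FreeMonoid.ofList w) : Matrix (Fin 2) (Fin 2) ℤ[T;T⁻¹]) 0 1

/-- The strict partial order `f ≺ g` on `ℤ[q]`: `g - f` is nonzero and has nonnegative
coefficients. -/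
def PolyPrec (f g : Polynomial ℤ) : Prop :=
  f ≠ g ∧ ∀ n : ℕ, 0 ≤ (g - f).coeff n

end QMarkoff

/-! Only finitely many factors of `s` matter for a given pair `u`, `v`, and balance leaves an open
interval of slopes compatible with all of them. So `u` and `v` are mechanical words with one common
irrational slope α and intercepts in [0, 1) (`IsBalanced.exists_mechanical`).

For a fixed length, raising the intercept makes the floors ⌊iα + ρ⌋ jump one at a time, since α is
irrational. Each jump turns a factor 01 into 10, or a final 0 into 1. A swap changes the (1,2) entry
by (q + q⁴) times a determinant of columns (`polyPrec_swap`), which is positive unless the word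
shows the unbalanced pattern 0 z̃ 01 z 1, z̃ being the reversal of z; mechanical words avoid it
(`polyPrec_flip`). Hence the entry grows with the intercept (`mechanical_eq_or_polyPrec`), and
lexicographic order is intercept order.

Between lengths n ≥ 1 and n + 1, the top word 1z of length n is compared with 0z0
(`polyPrec_cons_one`), which is at most the bottom word of length n + 1. -/

namespace QMarkoff

open Polynomial

/-! ### Polynomials with nonnegative coefficients -/

/-- All coefficients are nonnegative. -/
def CoeffNonneg (f : ℤ[X]) : Prop := ∀ n, 0 ≤ f.coeff n

/-- Nonzero, with nonnegative coefficients. -/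
def CoeffPos (f : ℤ[X]) : Prop := f ≠ 0 ∧ CoeffNonneg f

theorem CoeffNonneg.add {f g : ℤ[X]} (hf : CoeffNonneg f) (hg : CoeffNonneg g) :
    CoeffNonneg (f + g) := fun n => by
  rw [coeff_add]; exact add_nonneg (hf n) (hg n)

theorem CoeffNonneg.mul {f g : ℤ[X]} (hf : CoeffNonneg f) (hg : CoeffNonneg g) :
    CoeffNonneg (f * g) := fun n => by
  rw [coeff_mul]; exact Finset.sum_nonneg fun i _ => mul_nonneg (hf _) (hg _)

theorem coeffNonneg_zero : CoeffNonneg 0 := fun n => by simp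

theorem coeffNonneg_one : CoeffNonneg 1 := fun n => by
  rw [coeff_one]; split_ifs <;> simp

theorem coeffNonneg_X : CoeffNonneg X := fun n => by
  rw [coeff_X]; split_ifs <;> simp

theorem coeffNonneg_two : CoeffNonneg 2 := by
  rw [← one_add_one_eq_two]; exact coeffNonneg_one.add coeffNonneg_one

theorem CoeffNonneg.pow {f : ℤ[X]} (hf : CoeffNonneg f) (n : ℕ) : CoeffNonneg (f ^ n) := by
  induction n with
  | zero => rw [pow_zero]; exact coeffNonneg_one
  | succ n ih => rw [pow_succ]; exact ih.mul hf

theorem CoeffPos.mul {f g : ℤ[X]} (hf : CoeffPos f) (hg : CoeffPos g) : CoeffPos (f * g) :=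
  ⟨mul_ne_zero hf.1 hg.1, hf.2.mul hg.2⟩

theorem CoeffPos.add_nonneg {f g : ℤ[X]} (hf : CoeffPos f) (hg : CoeffNonneg g) :
    CoeffPos (f + g) := by
  refine ⟨fun h => hf.1 ?_, hf.2.add hg⟩
  ext n
  have h1 := hf.2 n
  have h2 := hg n
  have h3 : f.coeff n + g.coeff n = 0 := by rw [← coeff_add, h, coeff_zero]
  rw [coeff_zero]; omega

theorem coeffPos_one : CoeffPos 1 := ⟨one_ne_zero, coeffNonneg_one⟩

theorem coeffPos_X : CoeffPos X := ⟨X_ne_zero, coeffNonneg_X⟩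

theorem CoeffPos.pow {f : ℤ[X]} (hf : CoeffPos f) (n : ℕ) : CoeffPos (f ^ n) :=
  ⟨pow_ne_zero n hf.1, hf.2.pow n⟩

theorem polyPrec_iff {f g : ℤ[X]} : PolyPrec f g ↔ CoeffPos (g - f) := by
  unfold PolyPrec CoeffPos CoeffNonneg
  rw [sub_ne_zero, ne_comm]

theorem PolyPrec.trans {f g h : ℤ[X]} (h₁ : PolyPrec f g) (h₂ : PolyPrec g h) :
    PolyPrec f h := by
  rw [polyPrec_iff] at *
  have := h₁.add_nonneg h₂.2
  rwa [show g - f + (h - g) = h - f by ring] at this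

/-! ### The matrices over `ℤ[X]` -/

/-- The images of the letters, as matrices over `ℤ[X]`. -/
noncomputable def letterMatrix : Fin 2 → Matrix (Fin 2) (Fin 2) ℤ[X] :=
  ![!![X + X ^ 2, 1; X, 1], !![X + 2 * X ^ 2 + X ^ 3 + X ^ 4, 1 + X; X + X ^ 2, 1]]

/-- The image of a word, as a matrix over `ℤ[X]`. -/
noncomputable def wordMatrix (w : List (Fin 2)) : Matrix (Fin 2) (Fin 2) ℤ[X] :=
  (w.map letterMatrix).prod

theorem wordMatrix_nil : wordMatrix [] = 1 := rfl

theorem wordMatrix_cons (a : Fin 2) (w : List (Fin 2)) :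
    wordMatrix (a :: w) = letterMatrix a * wordMatrix w := by
  simp [wordMatrix]

theorem wordMatrix_append (v w : List (Fin 2)) :
    wordMatrix (v ++ w) = wordMatrix v * wordMatrix w := by
  simp [wordMatrix]

theorem wordMatrix_singleton (a : Fin 2) : wordMatrix [a] = letterMatrix a := by
  simp [wordMatrix]

theorem matrix_image_zero {A : Type*} [CommRing A] {t t' : A} (h : t * t' = 1) :
    !![t, 1; 0, 1] ^ 2 * !![0, -t'; 1, 0] * !![t, 1; 0, 1] = !![t + t ^ 2, 1; t, 1] := by
  rw [pow_two]
  ext i j : 2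
  fin_cases i <;> fin_cases j <;> simp <;> grind

theorem matrix_image_one {A : Type*} [CommRing A] {t t' : A} (h : t * t' = 1) :
    !![t, 1; 0, 1] ^ 3 * !![0, -t'; 1, 0] * !![t, 1; 0, 1] ^ 2 * !![0, -t'; 1, 0] *
      !![t, 1; 0, 1] = !![t + 2 * t ^ 2 + t ^ 3 + t ^ 4, 1 + t; t + t ^ 2, 1] := by
  rw [pow_three, pow_two]
  ext i j : 2
  fin_cases i <;> fin_cases j <;> simp <;> grind

theorem coe_muq_of (a : Fin 2) :
    (muq (FreeMonoid.of a) : Matrix (Fin 2) (Fin 2) (LaurentPolynomial ℤ)) =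
      (letterMatrix a).map toLaurent := by
  have hR : (Rq : Matrix (Fin 2) (Fin 2) (LaurentPolynomial ℤ)) =
    !![LaurentPolynomial.T 1, 1; 0, 1] := rfl
  have hS : (Sq : Matrix (Fin 2) (Fin 2) (LaurentPolynomial ℤ)) =
    !![0, -LaurentPolynomial.T (-1); 1, 0] := rfl
  have hX : (toLaurent (X : ℤ[X])) = LaurentPolynomial.T 1 := toLaurent_X
  have h2 : toLaurent (2 : ℤ[X]) = 2 := map_ofNat _ 2
  fin_cases a
  · have := matrix_image_zero T_one_mul
    simp only [muq, FreeMonoid.lift_eval_of, letterMatrix]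
    simp only [Fin.zero_eta, Matrix.cons_val_zero, Units.val_mul, Units.val_pow_eq_pow_val,
      hR, hS, this]
    ext i j : 2
    fin_cases i <;> fin_cases j <;> simp [hX]
  · have := matrix_image_one T_one_mul
    simp only [muq, FreeMonoid.lift_eval_of, letterMatrix]
    simp only [Fin.mk_one, Matrix.cons_val_one, Matrix.cons_val_fin_one, Units.val_mul,
      Units.val_pow_eq_pow_val, hR, hS, this]
    ext i j : 2
    fin_cases i <;> fin_cases j <;> simp [hX, h2]

theorem coe_muq (w : List (Fin 2)) :
    (muq (FreeMonoid.ofList w) : Matrix (Fin 2) (Fin 2) (LaurentPolynomial ℤ)) =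
      (wordMatrix w).map toLaurent := by
  induction w with
  | nil =>
    rw [FreeMonoid.ofList_nil, map_one, wordMatrix_nil, Units.val_one,
      Matrix.map_one _ (map_zero _) (map_one _)]
  | cons a w ih =>
    rw [FreeMonoid.ofList_cons, map_mul, Units.val_mul, ih, coe_muq_of, wordMatrix_cons,
      Matrix.map_mul]

theorem toLaurent_wordMatrix (w : List (Fin 2)) : toLaurent (wordMatrix w 0 1) = muq12 w := by
  rw [muq12, coe_muq, Matrix.map_apply]

theorem wordMatrix_cons_zero (w : List (Fin 2)) :
    wordMatrix (0 :: w) =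
      !![(X + X ^ 2) * wordMatrix w 0 0 + wordMatrix w 1 0,
        (X + X ^ 2) * wordMatrix w 0 1 + wordMatrix w 1 1;
        X * wordMatrix w 0 0 + wordMatrix w 1 0, X * wordMatrix w 0 1 + wordMatrix w 1 1] := by
  rw [wordMatrix_cons]
  ext i j : 2
  fin_cases i <;> fin_cases j <;> simp [letterMatrix, Matrix.mul_apply, Fin.sum_univ_two]

theorem wordMatrix_cons_one (w : List (Fin 2)) :
    wordMatrix (1 :: w) =
      !![(X + 2 * X ^ 2 + X ^ 3 + X ^ 4) * wordMatrix w 0 0 + (1 + X) * wordMatrix w 1 0,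
        (X + 2 * X ^ 2 + X ^ 3 + X ^ 4) * wordMatrix w 0 1 + (1 + X) * wordMatrix w 1 1;
        (X + X ^ 2) * wordMatrix w 0 0 + wordMatrix w 1 0,
        (X + X ^ 2) * wordMatrix w 0 1 + wordMatrix w 1 1] := by
  rw [wordMatrix_cons]
  ext i j : 2
  fin_cases i <;> fin_cases j <;> simp [letterMatrix, Matrix.mul_apply, Fin.sum_univ_two]

theorem wordMatrix_concat_zero (w : List (Fin 2)) :
    wordMatrix (w ++ [0]) =
      !![wordMatrix w 0 0 * (X + X ^ 2) + wordMatrix w 0 1 * X,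
        wordMatrix w 0 0 + wordMatrix w 0 1;
        wordMatrix w 1 0 * (X + X ^ 2) + wordMatrix w 1 1 * X,
        wordMatrix w 1 0 + wordMatrix w 1 1] := by
  rw [wordMatrix_append, wordMatrix_singleton]
  ext i j : 2
  fin_cases i <;> fin_cases j <;> simp [letterMatrix, Matrix.mul_apply, Fin.sum_univ_two]

theorem wordMatrix_concat_one (w : List (Fin 2)) :
    wordMatrix (w ++ [1]) =
      !![wordMatrix w 0 0 * (X + 2 * X ^ 2 + X ^ 3 + X ^ 4) + wordMatrix w 0 1 * (X + X ^ 2),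
        wordMatrix w 0 0 * (1 + X) + wordMatrix w 0 1;
        wordMatrix w 1 0 * (X + 2 * X ^ 2 + X ^ 3 + X ^ 4) + wordMatrix w 1 1 * (X + X ^ 2),
        wordMatrix w 1 0 * (1 + X) + wordMatrix w 1 1] := by
  rw [wordMatrix_append, wordMatrix_singleton]
  ext i j : 2
  fin_cases i <;> fin_cases j <;> simp [letterMatrix, Matrix.mul_apply, Fin.sum_univ_two]

theorem letter_cases (a : Fin 2) : a = 0 ∨ a = 1 := by omega

theorem wordMatrix_nonneg (w : List (Fin 2)) : ∀ i j, CoeffNonneg (wordMatrix w i j) := by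
  have hX (n : ℕ) := coeffNonneg_X.pow n
  have hX1 := coeffNonneg_X
  have h1 := coeffNonneg_one
  have hm := ((hX1.add (coeffNonneg_two.mul (hX 2))).add (hX 3)).add (hX 4)
  induction w with
  | nil =>
    rw [wordMatrix_nil]
    intro i j
    fin_cases i <;> fin_cases j <;> simp [coeffNonneg_zero, coeffNonneg_one]
  | cons a w ih =>
    rcases letter_cases a with rfl | rfl
    · rw [wordMatrix_cons_zero]
      intro i j
      fin_cases i <;> fin_cases j
      · exact ((hX1.add (hX 2)).mul (ih _ _)).add (ih _ _)
      · exact ((hX1.add (hX 2)).mul (ih _ _)).add (ih _ _)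
      · exact (hX1.mul (ih _ _)).add (ih _ _)
      · exact (hX1.mul (ih _ _)).add (ih _ _)
    · rw [wordMatrix_cons_one]
      intro i j
      fin_cases i <;> fin_cases j
      · exact (hm.mul (ih _ _)).add ((h1.add hX1).mul (ih _ _))
      · exact (hm.mul (ih _ _)).add ((h1.add hX1).mul (ih _ _))
      · exact ((hX1.add (hX 2)).mul (ih _ _)).add (ih _ _)
      · exact ((hX1.add (hX 2)).mul (ih _ _)).add (ih _ _)

theorem wordMatrix_diag_pos (w : List (Fin 2)) :
    CoeffPos (wordMatrix w 0 0) ∧ CoeffPos (wordMatrix w 1 1) := by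
  have hX (n : ℕ) := coeffNonneg_X.pow n
  have hX1 := coeffNonneg_X
  have h1 := coeffNonneg_one
  have hx := coeffPos_X.add_nonneg (hX 2)
  have hm := ((coeffPos_X.add_nonneg (coeffNonneg_two.mul (hX 2))).add_nonneg (hX 3)).add_nonneg
    (hX 4)
  induction w with
  | nil => rw [wordMatrix_nil]; simp [coeffPos_one]
  | cons a w ih =>
    have hw := wordMatrix_nonneg w
    rcases letter_cases a with rfl | rfl
    · rw [wordMatrix_cons_zero]
      constructor
      · exact (hx.mul ih.1).add_nonneg (hw _ _)
      · have := ih.2.add_nonneg (hX1.mul (hw 0 1))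
        rwa [add_comm] at this
    · rw [wordMatrix_cons_one]
      constructor
      · exact (hm.mul ih.1).add_nonneg ((h1.add hX1).mul (hw _ _))
      · have := ih.2.add_nonneg (hx.2.mul (hw 0 1))
        rwa [add_comm] at this

/-- Both letter matrices have lower-left entry X times the upper-right one, so each is fixed by
transposition followed by a diagonal conjugation, an anti-automorphism. The factor X is kept on the
left in the last identity to avoid dividing. -/
theorem wordMatrix_reverse (w : List (Fin 2)) :
    wordMatrix w.reverse 0 0 = wordMatrix w 0 0 ∧ wordMatrix w.reverse 1 1 = wordMatrix w 1 1 ∧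
      wordMatrix w.reverse 1 0 = X * wordMatrix w 0 1 ∧
      X * wordMatrix w.reverse 0 1 = wordMatrix w 1 0 := by
  induction w with
  | nil => simp [wordMatrix_nil]
  | cons a w ih =>
    obtain ⟨h1, h2, h3, h4⟩ := ih
    rw [List.reverse_cons]
    rcases letter_cases a with rfl | rfl
    · rw [wordMatrix_concat_zero, wordMatrix_cons_zero]
      simp only [Matrix.of_apply, Matrix.cons_val', Matrix.cons_val_zero, Matrix.cons_val_one,
        Matrix.cons_val_fin_one, h1, h2, h3]
      refine ⟨?_, ?_, ?_, ?_⟩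
      · linear_combination h4
      · trivial
      · ring
      · linear_combination h4
    · rw [wordMatrix_concat_one, wordMatrix_cons_one]
      simp only [Matrix.of_apply, Matrix.cons_val', Matrix.cons_val_zero, Matrix.cons_val_one,
        Matrix.cons_val_fin_one, h1, h2, h3]
      refine ⟨?_, ?_, ?_, ?_⟩
      · linear_combination (1 + X) * h4
      · ring
      · ring
      · linear_combination h4

/-! ### Elementary comparisons between words -/

/-- The determinant of the first column of `μ(v)` and the second column of `μ(w)` is positive
unless, after their longest common prefix, `v` continues with `0` and `w` with `1`. -/
theorem det_columns_pos (v w : List (Fin 2))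
    (h : ∀ z x y, ¬ (v = z ++ 0 :: x ∧ w = z ++ 1 :: y)) :
    CoeffPos (wordMatrix v 0 0 * wordMatrix w 1 1 - wordMatrix v 1 0 * wordMatrix w 0 1) := by
  induction v generalizing w with
  | nil => simpa [wordMatrix_nil] using (wordMatrix_diag_pos w).2
  | cons a v ih =>
    cases w with
    | nil => simpa [wordMatrix_nil] using (wordMatrix_diag_pos (a :: v)).1
    | cons b w =>
      have hX (n : ℕ) := coeffNonneg_X.pow n
      rcases letter_cases a with rfl | rfl <;> rcases letter_cases b with rfl | rfl
      -- A common first letter multiplies the determinant by that of its matrix: X² for 0, X⁴ for 1.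
      · have := (coeffPos_X.pow 2).mul
          (ih w fun z x y hz => h (0 :: z) x y (by simp [hz.1, hz.2]))
        rw [wordMatrix_cons_zero, wordMatrix_cons_zero]
        convert this using 1
        simp
        ring
      · exact absurd ⟨rfl, rfl⟩ (h [] v w)
      · rw [wordMatrix_cons_zero, wordMatrix_cons_one]
        have hv := wordMatrix_nonneg v
        have hw := wordMatrix_nonneg w
        have h1 := ((((coeffPos_X.pow 2).add_nonneg (hX 3)).add_nonneg (hX 4)).mul
          ((wordMatrix_diag_pos v).1.mul (wordMatrix_diag_pos w).2)).add_nonneg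
          (((hX 5).mul ((hv 0 0).mul (hw 0 1))).add (coeffNonneg_X.mul ((hv 1 0).mul (hw 1 1))))
        convert h1 using 1
        simp
        ring
      · have := (coeffPos_X.pow 4).mul
          (ih w fun z x y hz => h (1 :: z) x y (by simp [hz.1, hz.2]))
        rw [wordMatrix_cons_one, wordMatrix_cons_one]
        convert this using 1
        simp
        ring

/-- The commutator μ(1)μ(0) − μ(0)μ(1) is (X + X⁴) times the matrix with rows (0, 1) and (−X, 0).
Reversal turns the first row of μ(p) into a column, so the difference is (X + X⁴) times the
determinant of `det_columns_pos`. -/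
theorem polyPrec_swap (p r : List (Fin 2))
    (h : ∀ z x y, ¬ (p.reverse = z ++ 0 :: x ∧ r = z ++ 1 :: y)) :
    PolyPrec (wordMatrix (p ++ 0 :: 1 :: r) 0 1) (wordMatrix (p ++ 1 :: 0 :: r) 0 1) := by
  rw [polyPrec_iff]
  have h1 := (coeffPos_X.add_nonneg (coeffNonneg_X.pow 4)).mul (det_columns_pos _ _ h)
  obtain ⟨e1, -, e3, -⟩ := wordMatrix_reverse p
  rw [e1, e3] at h1
  rw [wordMatrix_append, wordMatrix_append, wordMatrix_cons_zero, wordMatrix_cons_one,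
    wordMatrix_cons_zero, wordMatrix_cons_one]
  convert h1 using 1
  simp [Matrix.mul_apply, Fin.sum_univ_two]
  ring

theorem polyPrec_concat (p : List (Fin 2)) :
    PolyPrec (wordMatrix (p ++ [0]) 0 1) (wordMatrix (p ++ [1]) 0 1) := by
  rw [polyPrec_iff, wordMatrix_concat_zero, wordMatrix_concat_one]
  convert coeffPos_X.mul (wordMatrix_diag_pos p).1 using 1
  simp
  ring

/-- Needed in `polyPrec_cons_one` when `z` ends in 0; there the subtracted terms do not cancel by
themselves. -/
theorem coeffPos_row_sub (w : List (Fin 2)) :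
    CoeffPos (wordMatrix w 0 0 - X * wordMatrix w 0 1) := by
  rcases List.eq_nil_or_concat' w with rfl | ⟨w, a, rfl⟩
  · simp [wordMatrix_nil, coeffPos_one]
  · have hX (n : ℕ) := coeffNonneg_X.pow n
    have hw := (wordMatrix_diag_pos w).1
    rcases letter_cases a with rfl | rfl
    · rw [wordMatrix_concat_zero]
      convert (coeffPos_X.pow 2).mul hw using 1
      simp
      ring
    · rw [wordMatrix_concat_one]
      convert ((((coeffPos_X.pow 2).add_nonneg (hX 3)).add_nonneg (hX 4)).mul hw).add_nonneg
        ((hX 2).mul (wordMatrix_nonneg w 0 1)) using 1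
      simp
      ring

theorem polyPrec_cons_one (z : List (Fin 2)) :
    PolyPrec (wordMatrix (1 :: z) 0 1) (wordMatrix (0 :: (z ++ [0])) 0 1) := by
  have hX (n : ℕ) := coeffNonneg_X.pow n
  have key : CoeffPos ((X + X ^ 2) * wordMatrix z 0 0 + wordMatrix z 1 0
      - (X ^ 2 + X ^ 3 + X ^ 4) * wordMatrix z 0 1 - X * wordMatrix z 1 1) := by
    rcases List.eq_nil_or_concat' z with rfl | ⟨w, a, rfl⟩
    · rw [wordMatrix_nil]
      convert coeffPos_X.pow 2 using 1
      simp
    · have hw := wordMatrix_nonneg w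
      rcases letter_cases a with rfl | rfl
      · rw [wordMatrix_concat_zero]
        convert ((coeffPos_X.pow 3).mul (coeffPos_row_sub w)).add_nonneg
          ((hX 2).mul (hw 1 0)) using 1
        simp
        ring
      · rw [wordMatrix_concat_one]
        convert ((((((coeffPos_X.pow 3).add_nonneg (hX 4)).add_nonneg (hX 5)).add_nonneg
          (hX 6)).mul (wordMatrix_diag_pos w).1).add_nonneg ((hX 3).mul (hw 0 1))).add_nonneg
          (((((hX 2).add (hX 3)).add (hX 4)).mul (hw 1 0)).add ((hX 2).mul (hw 1 1))) using 1
        simp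
        ring
  rw [polyPrec_iff, wordMatrix_cons_zero, wordMatrix_cons_one, wordMatrix_concat_zero]
  convert key using 1
  simp
  ring

end QMarkoff
namespace QMarkoff

open Polynomial

/-! ### Words given by their increments -/

/-- The word of length `n` whose `i`-th letter is `0` if and only if `U i = U (i + 1)`. -/
def incrementWord (U : ℕ → ℤ) (n : ℕ) : List (Fin 2) :=
  (List.range n).map fun i => if U i = U (i + 1) then 0 else 1

/-- All increments are `0` or `1`. -/
def IsStep (U : ℕ → ℤ) : Prop := ∀ i, U (i + 1) = U i ∨ U (i + 1) = U i + 1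

theorem length_incrementWord (U : ℕ → ℤ) (n : ℕ) : (incrementWord U n).length = n := by
  simp [incrementWord]

theorem incrementWord_congr {U V : ℕ → ℤ} {n : ℕ} (h : ∀ i ≤ n, U i = V i) :
    incrementWord U n = incrementWord V n := by
  refine List.map_congr_left fun i hi => ?_
  rw [List.mem_range] at hi
  rw [h i hi.le, h (i + 1) hi]

theorem incrementWord_add (U : ℕ → ℤ) (m n : ℕ) :
    incrementWord U (m + n) = incrementWord U m ++ incrementWord (fun i => U (m + i)) n := by
  simp [incrementWord, List.range_add, Function.comp_def, add_assoc]

theorem incrementWord_one (U : ℕ → ℤ) :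
    incrementWord U 1 = [if U 0 = U 1 then 0 else 1] := rfl

theorem IsStep.shift {U : ℕ → ℤ} (h : IsStep U) (k : ℕ) : IsStep fun i => U (k + i) :=
  fun i => h (k + i)

theorem count_one_incrementWord {U : ℕ → ℤ} (h : IsStep U) (n : ℕ) :
    ((incrementWord U n).count 1 : ℤ) = U n - U 0 := by
  induction n with
  | zero => simp [incrementWord]
  | succ n ih =>
    rw [incrementWord_add, List.count_append, incrementWord_one]
    rcases h n with h | h
    · simp [h, ih]
    · simp [h, ih]
      omega

/-- Raising one partial sum by 1 swaps the letters on either side of it, or changes the last letter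
when `j = n`. The hypothesis `hbal` is the trace of balance that excludes the bad case of
`polyPrec_swap`. -/
theorem polyPrec_flip {U V : ℕ → ℤ} (hU : IsStep U) (hV : IsStep V) {j n : ℕ} (hj : 0 < j)
    (hjn : j ≤ n) (hne : ∀ i ≤ n, i ≠ j → V i = U i) (hVj : V j = U j + 1)
    (hbal : ∀ a b, a + b = 2 * j → U a + U b < 2 * U j + 2) :
    PolyPrec (wordMatrix (incrementWord U n) 0 1) (wordMatrix (incrementWord V n) 0 1) := by
  obtain ⟨k, rfl⟩ : ∃ k, j = k + 1 := ⟨j - 1, by omega⟩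
  have hpre : incrementWord V k = incrementWord U k :=
    incrementWord_congr fun i hi => hne i (by omega) (by omega)
  have hVk := hne k (by omega) (by omega)
  have hUk : U (k + 1) = U k := by
    have := hU k; have := hV k; omega
  rcases hjn.eq_or_lt with rfl | hlt
  · rw [incrementWord_add, incrementWord_add, hpre, incrementWord_one, incrementWord_one]
    simp only [add_zero, hUk, hVj, hVk]
    simpa using polyPrec_concat (incrementWord U k)
  · obtain ⟨m, rfl⟩ : ∃ m, n = k + (1 + (1 + m)) := ⟨n - k - 2, by omega⟩
    have hVk2 := hne (k + 2) (by omega) (by omega)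
    have hUk2 : U (k + 2) = U (k + 1) + 1 := by
      have := hU (k + 1); have := hV (k + 1)
      simp only [add_assoc, Nat.reduceAdd] at *
      omega
    have hsuf : incrementWord (fun i => V (k + (1 + (1 + i)))) m =
        incrementWord (fun i => U (k + (1 + (1 + i)))) m :=
      incrementWord_congr fun i hi => hne _ (by omega) (by omega)
    have key := polyPrec_swap (incrementWord U k) (incrementWord (fun i => U (k + (1 + (1 + i)))) m)
      (by
        -- In the bad case the blocks 0 z̃ 0 and 1 z 1 meet at index `j`. They have equal length and
        -- their counts of ones differ by 2, so their outer endpoints violate `hbal`.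
        rintro z x y ⟨hz, hr⟩
        have hz' : incrementWord U k = x.reverse ++ 0 :: z.reverse := by
          rw [← List.reverse_reverse (incrementWord U k), hz]; simp
        have hk : k = x.length + (1 + z.length) := by
          have := congrArg List.length hz'
          simp [length_incrementWord] at this; omega
        have hm : m = z.length + (1 + y.length) := by
          have := congrArg List.length hr
          simp [length_incrementWord] at this; omega
        have c1 := count_one_incrementWord hU k
        have c2 := count_one_incrementWord hU x.length
        have e2 : incrementWord U x.length = x.reverse := by
          rw [hk, incrementWord_add] at hz'
          exact (List.append_inj hz' (by simp [length_incrementWord])).1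
        have hS := (((hU.shift k).shift 1).shift 1)
        have c3 := count_one_incrementWord hS (z.length + 1)
        have e3 : incrementWord (fun i => U (k + (1 + (1 + i)))) (z.length + 1) = z ++ [1] := by
          rw [hm, ← add_assoc, incrementWord_add] at hr
          rw [List.append_cons] at hr
          exact (List.append_inj hr (by simp [length_incrementWord])).1
        rw [hz'] at c1
        rw [e2] at c2
        rw [e3] at c3
        simp [List.count_append] at c1 c2 c3
        have := hbal x.length (k + (1 + (1 + (z.length + 1)))) (by omega)
        rw [show k + (1 + 1) = k + 2 from rfl] at c3
        omega)
    rw [incrementWord_add, incrementWord_add, incrementWord_add, incrementWord_add V,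
      incrementWord_add (fun i => V (k + i)), incrementWord_add (fun i => V (k + (1 + i))),
      hpre, hsuf]
    simp only [incrementWord_one, add_zero, hUk, hVj, hVk]
    simpa [hUk, hUk2, hVk2] using key

end QMarkoff
namespace QMarkoff

open Polynomial

/-! ### Mechanical words -/

/-- The sequence of partial sums of the mechanical word of slope `α` and intercept `ρ`. -/
noncomputable def mechanical (α ρ : ℝ) (i : ℕ) : ℤ := ⌊i * α + ρ⌋

theorem isStep_mechanical {α : ℝ} (h0 : 0 < α) (h1 : α < 1) (ρ : ℝ) :
    IsStep (mechanical α ρ) := by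
  intro i
  have h2 : mechanical α ρ i ≤ mechanical α ρ (i + 1) := by
    refine Int.floor_le_floor ?_
    push_cast
    nlinarith
  have h3 : mechanical α ρ (i + 1) < mechanical α ρ i + 2 := by
    refine Int.floor_lt.2 ?_
    have := Int.lt_floor_add_one (i * α + ρ)
    unfold mechanical
    push_cast
    nlinarith
  omega

theorem mechanical_le {α ρ ρ' : ℝ} (h : ρ ≤ ρ') (i : ℕ) :
    mechanical α ρ i ≤ mechanical α ρ' i :=
  Int.floor_le_floor (by linarith)

theorem mechanical_lt_add_two {α ρ ρ' : ℝ} (h : ρ' < ρ + 1) (i : ℕ) :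
    mechanical α ρ' i < mechanical α ρ i + 2 := by
  refine Int.floor_lt.2 ?_
  have := Int.lt_floor_add_one (i * α + ρ)
  unfold mechanical
  push_cast
  linarith

theorem mechanical_zero {α ρ : ℝ} (h0 : 0 ≤ ρ) (h1 : ρ < 1) : mechanical α ρ 0 = 0 := by
  rw [mechanical, Int.floor_eq_zero_iff]
  simp [h0, h1]

/-- The two floors sum to at most 2(jα + ρ), which is below 2⌊jα + ρ⌋ + 2. -/
theorem mechanical_add_lt {α ρ : ℝ} {a b j : ℕ} (h : a + b = 2 * j) :
    mechanical α ρ a + mechanical α ρ b < 2 * mechanical α ρ j + 2 := by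
  have ha := Int.floor_le (a * α + ρ)
  have hb := Int.floor_le (b * α + ρ)
  have hj := Int.lt_floor_add_one (j * α + ρ)
  have h' : (a : ℝ) + b = 2 * j := by exact_mod_cast h
  have h'' : (a : ℝ) * α + b * α = 2 * (j * α) := by rw [← add_mul, h']; ring
  unfold mechanical
  rify
  linarith

theorem mechanical_eq_or_polyPrec {α : ℝ} (hα : Irrational α) (h0 : 0 < α) (h1 : α < 1) (n : ℕ)
    {ρ ρ' : ℝ} (hρ : 0 ≤ ρ) (hρρ' : ρ ≤ ρ') (hρ' : ρ' < 1) :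
    (∀ i ≤ n, mechanical α ρ i = mechanical α ρ' i) ∨
      PolyPrec (wordMatrix (incrementWord (mechanical α ρ) n) 0 1)
        (wordMatrix (incrementWord (mechanical α ρ') n) 0 1) := by
  -- Induction on the set of indices whose floors still have to jump.
  obtain ⟨D, hD⟩ : ∃ D : Finset ℕ, ∀ i, i ∈ D ↔ i ≤ n ∧ mechanical α ρ i < mechanical α ρ' i :=
    ⟨(Finset.range (n + 1)).filter fun i => mechanical α ρ i < mechanical α ρ' i, by
      simp [Order.lt_add_one_iff]⟩
  induction D using Finset.strongInduction generalizing ρ with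
  | H D ih =>
    rcases D.eq_empty_or_nonempty with rfl | hne
    · left
      intro i hi
      by_contra hne
      exact absurd ((hD i).2 ⟨hi, lt_of_le_of_ne (mechanical_le hρρ' i) hne⟩) (by simp)
    right
    -- The minimised quantity is the intercept at which the floor at `i` jumps; `j` jumps first, at
    -- intercept `t`.
    obtain ⟨j, hj, hmin⟩ := D.exists_min_image (fun i => (mechanical α ρ i : ℝ) + 1 - i * α) hne
    set t : ℝ := (mechanical α ρ j : ℝ) + 1 - j * α with ht
    have hjn := ((hD j).1 hj).1
    have hjlt := ((hD j).1 hj).2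
    have hρt : ρ < t := by
      have := Int.lt_floor_add_one (j * α + ρ)
      rw [ht, mechanical]
      linarith
    have htρ' : t ≤ ρ' := by
      have h2 := Int.floor_le (j * α + ρ')
      have h3 : ((mechanical α ρ j + 1 : ℤ) : ℝ) ≤ mechanical α ρ' j := by exact_mod_cast hjlt
      rw [show (⌊j * α + ρ'⌋ : ℝ) = mechanical α ρ' j from rfl] at h2
      push_cast at h3
      linarith
    have htj : mechanical α t j = mechanical α ρ j + 1 := by
      rw [mechanical, ht, show (j : ℝ) * α + ((mechanical α ρ j : ℝ) + 1 - j * α) =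
        ((mechanical α ρ j + 1 : ℤ) : ℝ) by push_cast; ring, Int.floor_intCast]
    have htne : ∀ i ≤ n, i ≠ j → mechanical α t i = mechanical α ρ i := by
      intro i hi hij
      by_contra hne
      have hlt := lt_of_le_of_ne (mechanical_le hρt.le i) (Ne.symm hne)
      have hiD := (hD i).2 ⟨hi, hlt.trans_le (mechanical_le htρ' i)⟩
      have h2 := hmin i hiD
      have h3 := Int.floor_le (i * α + t)
      have h4 : ((mechanical α ρ i + 1 : ℤ) : ℝ) ≤ mechanical α t i := by exact_mod_cast hlt
      rw [show (⌊i * α + t⌋ : ℝ) = mechanical α t i from rfl] at h3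
      push_cast at h4
      -- Two indices jumping together would make a nonzero integer multiple of α an integer.
      have h5 : (((i : ℤ) - j : ℤ) : ℝ) * α =
          ((mechanical α ρ i - mechanical α ρ j : ℤ) : ℝ) := by
        push_cast
        linarith
      exact (hα.intCast_mul (m := (i : ℤ) - j) (by omega)).ne_int _ h5
    have hj0 : 0 < j := by
      rcases Nat.eq_zero_or_pos j with rfl | h
      · rw [mechanical_zero hρ (by linarith), mechanical_zero (by linarith) hρ'] at hjlt
        omega
      · exact h
    have hstep := polyPrec_flip (isStep_mechanical h0 h1 ρ) (isStep_mechanical h0 h1 t) hj0 hjn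
      htne htj fun a b => mechanical_add_lt
    have hfin := ih (D.erase j) (Finset.erase_ssubset hj) (ρ := t) (by linarith) htρ' (by
      intro i
      rw [Finset.mem_erase, hD]
      constructor
      · rintro ⟨hij, hi, hlt⟩
        rw [htne i hi hij]
        exact ⟨hi, hlt⟩
      · rintro ⟨hi, hlt⟩
        refine ⟨?_, hi, (mechanical_le hρt.le i).trans_lt hlt⟩
        rintro rfl
        have := mechanical_lt_add_two (α := α) (ρ := ρ) (ρ' := ρ') (by linarith) i
        omega)
    rcases hfin with h | h
    · rwa [← incrementWord_congr h]
    · exact hstep.trans h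

/-- For i ≥ 1 the number iα is not an integer, so its floor jumps strictly before intercept 1; an
intercept close enough to 1 is past all these jumps. -/
theorem exists_mechanical_eq_add_one {α : ℝ} (hα : Irrational α) (n : ℕ) {ρ : ℝ}
    (hρ : ρ < 1) :
    ∃ ρ', ρ ≤ ρ' ∧ ρ' < 1 ∧ ∀ i ≤ n, 0 < i → mechanical α ρ' i = mechanical α 0 i + 1 := by
  obtain ⟨m, hm, hm1⟩ := Order.exists_between_finsets
    (insert ρ ((Finset.Icc 1 n).image fun i : ℕ => (mechanical α 0 i : ℝ) + 1 - i * α)) {1} (by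
      intro x hx y hy
      rw [Finset.mem_singleton] at hy
      subst hy
      rw [Finset.mem_insert, Finset.mem_image] at hx
      rcases hx with rfl | ⟨i, hi, rfl⟩
      · exact hρ
      · have hi := (Finset.mem_Icc.1 hi).1
        have h1 := Int.floor_le (i * α + 0)
        have h2 := (hα.natCast_mul (m := i) (by omega)).ne_int (mechanical α 0 i)
        have h3 : (mechanical α 0 i : ℝ) ≤ i * α := by simpa [mechanical] using h1
        have := lt_of_le_of_ne h3 h2.symm
        linarith)
  have hm1 := hm1 1 (by simp)
  refine ⟨m, (hm ρ (by simp)).le, hm1, fun i hi hi0 => ?_⟩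
  have h1 := hm ((mechanical α 0 i : ℝ) + 1 - i * α) (by
    simp only [Finset.mem_insert, Finset.mem_image, Finset.mem_Icc]
    exact Or.inr ⟨i, ⟨hi0, hi⟩, rfl⟩)
  have h2 := Int.lt_floor_add_one (i * α + 0)
  rw [show (⌊i * α + 0⌋ : ℝ) = mechanical α 0 i from rfl] at h2
  rw [mechanical, Int.floor_eq_iff]
  push_cast
  constructor <;> linarith

/-- The chain raises ρ to an intercept σ near 1, passes from length n to n + 1 at intercept 0, then
raises 0 to ρ'. For n ≥ 1 the words at σ and 0 of length n are 1z and 0z with the same z. -/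
theorem polyPrec_mechanical_succ {α : ℝ} (hα : Irrational α) (h0 : 0 < α) (h1 : α < 1) (n : ℕ)
    {ρ ρ' : ℝ} (hρ : 0 ≤ ρ) (hρ1 : ρ < 1) (hρ' : 0 ≤ ρ') (hρ'1 : ρ' < 1) :
    PolyPrec (wordMatrix (incrementWord (mechanical α ρ) n) 0 1)
      (wordMatrix (incrementWord (mechanical α ρ') (n + 1)) 0 1) := by
  have hz : mechanical α 0 0 = 0 := mechanical_zero le_rfl one_pos
  have hz1 : mechanical α 0 1 = 0 := by
    rw [mechanical, Int.floor_eq_zero_iff]; simp [h0.le, h1]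
  have key : PolyPrec (wordMatrix (incrementWord (mechanical α ρ) n) 0 1)
      (wordMatrix (incrementWord (mechanical α 0) (n + 1)) 0 1) := by
    rcases n.eq_zero_or_pos with rfl | hn
    · rw [incrementWord_one, hz, hz1, polyPrec_iff]
      convert coeffPos_one using 1
      simp [incrementWord, wordMatrix_nil, wordMatrix_singleton, letterMatrix]
    obtain ⟨m, rfl⟩ : ∃ m, n = 1 + m := ⟨n - 1, by omega⟩
    obtain ⟨σ, hρσ, hσ1, hσ⟩ := exists_mechanical_eq_add_one hα (1 + m) hρ1
    have hstar : PolyPrec (wordMatrix (incrementWord (mechanical α σ) (1 + m)) 0 1)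
        (wordMatrix (incrementWord (mechanical α 0) (1 + m + 1)) 0 1) := by
      set z := incrementWord (fun i => mechanical α 0 (1 + i)) m with hzdef
      have e1 : incrementWord (mechanical α σ) (1 + m) = 1 :: z := by
        have : incrementWord (fun i => mechanical α σ (1 + i)) m = z := by
          refine List.map_congr_left fun i hi => ?_
          rw [List.mem_range] at hi
          simp only [hσ (1 + i) (by omega) (by omega), hσ (1 + (i + 1)) (by omega) (by omega),
            add_left_inj]
        rw [incrementWord_add, this, incrementWord_one, mechanical_zero (hρ.trans hρσ) hσ1,
          hσ 1 (by omega) one_pos, hz1]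
        simp
      have e2 : incrementWord (mechanical α 0) (1 + m) = 0 :: z := by
        rw [incrementWord_add, incrementWord_one, hz, hz1]
        simp [hzdef]
      rw [e1, incrementWord_add, e2, incrementWord_one]
      split_ifs
      · exact polyPrec_cons_one z
      · exact (polyPrec_cons_one z).trans (polyPrec_concat (0 :: z))
    rcases mechanical_eq_or_polyPrec hα h0 h1 (1 + m) hρ hρσ hσ1 with h | h
    · rwa [incrementWord_congr h]
    · exact h.trans hstar
  rcases mechanical_eq_or_polyPrec hα h0 h1 (n + 1) le_rfl hρ' hρ'1 with h | h
  · rwa [← incrementWord_congr h]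
  · exact key.trans h

theorem polyPrec_mechanical_of_lt {α : ℝ} (hα : Irrational α) (h0 : 0 < α) (h1 : α < 1)
    {m n : ℕ} (hmn : m < n) {ρ ρ' : ℝ} (hρ : 0 ≤ ρ) (hρ1 : ρ < 1) (hρ' : 0 ≤ ρ')
    (hρ'1 : ρ' < 1) :
    PolyPrec (wordMatrix (incrementWord (mechanical α ρ) m) 0 1)
      (wordMatrix (incrementWord (mechanical α ρ') n) 0 1) := by
  induction n, hmn using Nat.le_induction with
  | base => exact polyPrec_mechanical_succ hα h0 h1 m hρ hρ1 hρ' hρ'1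
  | succ n _ ih => exact ih.trans (polyPrec_mechanical_succ hα h0 h1 n hρ' hρ'1 hρ' hρ'1)

/-- Radix order on mechanical words of the same slope. -/
theorem polyPrec_mechanical_of_radixLT {α : ℝ} (hα : Irrational α) (h0 : 0 < α) (h1 : α < 1)
    {m n : ℕ} {ρ ρ' : ℝ} (hρ : 0 ≤ ρ) (hρ1 : ρ < 1) (hρ' : 0 ≤ ρ') (hρ'1 : ρ' < 1)
    (h : RadixLT (incrementWord (mechanical α ρ) m) (incrementWord (mechanical α ρ') n)) :
    PolyPrec (wordMatrix (incrementWord (mechanical α ρ) m) 0 1)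
      (wordMatrix (incrementWord (mechanical α ρ') n) 0 1) := by
  rw [RadixLT, length_incrementWord, length_incrementWord] at h
  rcases h with h | ⟨rfl, h⟩
  · exact polyPrec_mechanical_of_lt hα h0 h1 h hρ hρ1 hρ' hρ'1
  rcases List.lt_iff_exists.1 h with ⟨-, h⟩ | ⟨i, hi, _, hpre, hlt⟩
  · simp [length_incrementWord] at h
  rw [length_incrementWord] at hi
  have hU := isStep_mechanical h0 h1 ρ
  have hV := isStep_mechanical h0 h1 ρ'
  have hagree : ∀ j ≤ i, mechanical α ρ j = mechanical α ρ' j := by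
    intro j hj
    induction j with
    | zero => rw [mechanical_zero hρ hρ1, mechanical_zero hρ' hρ'1]
    | succ j ih =>
      have h2 := hpre j (by omega)
      simp only [incrementWord, List.getElem_map, List.getElem_range] at h2
      have h3 := ih (by omega)
      have h4 := hU j
      have h5 := hV j
      split_ifs at h2 <;> simp at h2 <;> omega
  have hi1 : mechanical α ρ (i + 1) < mechanical α ρ' (i + 1) := by
    simp only [incrementWord, List.getElem_map, List.getElem_range] at hlt
    have h3 := hagree i le_rfl
    have h4 := hU i
    have h5 := hV i
    split_ifs at hlt <;> simp at hlt
    omega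
  -- Floors are monotone in the intercept, so the first differing letter decides the order of
  -- intercepts.
  have hle : ρ ≤ ρ' := by
    by_contra hcon
    exact absurd (mechanical_le (α := α) (le_of_not_ge hcon) (i + 1)) (by omega)
  rcases mechanical_eq_or_polyPrec hα h0 h1 m hρ hle hρ'1 with h' | h'
  · exact absurd (h' (i + 1) hi) hi1.ne
  · exact h'

end QMarkoff
namespace QMarkoff

open Polynomial

/-! ### Factors of balanced sequences are mechanical words -/

/-- The number of ones among the `n` letters of `s` from position `k` on. -/
def ones (s : ℤ → Fin 2) (k : ℤ) (n : ℕ) : ℤ := ∑ i ∈ Finset.range n, ((s (k + i)).val : ℤ)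

theorem ones_zero (s : ℤ → Fin 2) (k : ℤ) : ones s k 0 = 0 := rfl

theorem ones_succ (s : ℤ → Fin 2) (k : ℤ) (n : ℕ) :
    ones s k (n + 1) = ones s k n + (s (k + n)).val :=
  Finset.sum_range_succ _ _

theorem ones_add (s : ℤ → Fin 2) (k : ℤ) (m n : ℕ) :
    ones s k (m + n) = ones s k m + ones s (k + m) n := by
  simp [ones, Finset.sum_range_add, add_assoc]

theorem ones_nonneg (s : ℤ → Fin 2) (k : ℤ) (n : ℕ) : 0 ≤ ones s k n :=
  Finset.sum_nonneg fun _ _ => Int.natCast_nonneg _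

theorem ones_le (s : ℤ → Fin 2) (k : ℤ) (n : ℕ) : ones s k n ≤ n := by
  induction n with
  | zero => simp [ones_zero]
  | succ n ih => rw [ones_succ]; push_cast; omega

theorem count_one_ofFn (s : ℤ → Fin 2) (k : ℤ) (n : ℕ) :
    ((List.ofFn fun i : Fin n => s (k + (i : ℕ))).count 1 : ℤ) = ones s k n := by
  induction n with
  | zero => simp [ones_zero]
  | succ n ih =>
    rw [List.ofFn_succ', List.concat_eq_append, List.count_append, Nat.cast_add, ones_succ]
    congr 1
    rcases letter_cases (s (k + n)) with h | h <;> simp [h]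

theorem exists_eq_incrementWord {s : ℤ → Fin 2} {w : List (Fin 2)} (hw : w ∈ language s) :
    ∃ k n, w = incrementWord (ones s k) n := by
  obtain ⟨k, n, rfl⟩ := hw
  refine ⟨k, n, List.ext_getElem (by simp [length_incrementWord]) fun i h₁ h₂ => ?_⟩
  simp only [List.getElem_ofFn, incrementWord, List.getElem_map, List.getElem_range, ones_succ]
  rcases letter_cases (s (k + i)) with h | h <;> simp [h]

theorem IsBalanced.ones_le_add_one {s : ℤ → Fin 2} (hs : IsBalanced s) (k l : ℤ) (n : ℕ) :
    ones s k n ≤ ones s l n + 1 := by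
  rcases n.eq_zero_or_pos with rfl | hn
  · simp [ones_zero]
  have := hs n hn _ ⟨k, n, rfl⟩ _ ⟨l, n, rfl⟩ (by simp) (by simp) 1
  rw [count_one_ofFn, count_one_ofFn, abs_le] at this
  omega

theorem IsBalanced.mul_le_ones {s : ℤ → Fin 2} (hs : IsBalanced s) (k l : ℤ) (n m : ℕ) :
    m * (ones s k n - 1) ≤ ones s l (m * n) := by
  induction m with
  | zero => simp [ones_zero]
  | succ m ih =>
    have := hs.ones_le_add_one k (l + (m * n : ℕ)) n
    rw [Nat.succ_mul, ones_add]
    push_cast at *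
    linarith

theorem IsBalanced.ones_le_mul {s : ℤ → Fin 2} (hs : IsBalanced s) (k l : ℤ) (n m : ℕ) :
    ones s l (m * n) ≤ m * (ones s k n + 1) := by
  induction m with
  | zero => simp [ones_zero]
  | succ m ih =>
    have := hs.ones_le_add_one (l + (m * n : ℕ)) k n
    rw [Nat.succ_mul, ones_add]
    push_cast at *
    linarith

theorem IsBalanced.mul_lt_mul {s : ℤ → Fin 2} (hs : IsBalanced s) (k l : ℤ) {n m : ℕ}
    (hm : 0 < m) : m * (ones s k n - 1) < n * (ones s l m + 1) := by
  obtain ⟨m, rfl⟩ : ∃ m', m = m' + 1 := ⟨m - 1, by omega⟩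
  -- The block at `k` is counted exactly and only the blocks after it are estimated; this saves 1
  -- and makes the inequality strict.
  have h1 := hs.mul_le_ones k (k + n) n m
  have h2 := hs.ones_le_mul l k (m + 1) n
  rw [mul_comm n (m + 1), Nat.succ_mul, add_comm, ones_add] at h2
  push_cast at *
  linarith

/-- A balanced sequence has, on any finite set of factors, an irrational slope. -/
theorem IsBalanced.exists_slope {s : ℤ → Fin 2} (hs : IsBalanced s) (F : Finset (ℤ × ℕ)) :
    ∃ α : ℝ, Irrational α ∧ 0 < α ∧ α < 1 ∧
      ∀ k n, (k, n) ∈ F → |(ones s k n : ℝ) - n * α| < 1 := by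
  classical
  let G := F.filter fun p => 0 < p.2
  have hG : ∀ p ∈ G, (0 : ℝ) < p.2 := fun p hp => by exact_mod_cast (Finset.mem_filter.1 hp).2
  let lo := insert 0 (G.image fun p => ((ones s p.1 p.2 : ℝ) - 1) / p.2)
  let hi := insert 1 (G.image fun p => ((ones s p.1 p.2 : ℝ) + 1) / p.2)
  have hlohi : ∀ x ∈ lo, ∀ y ∈ hi, x < y := by
    simp only [lo, hi, Finset.forall_mem_insert, Finset.forall_mem_image]
    refine ⟨⟨one_pos, fun q hq => ?_⟩, fun p hp => ⟨?_, fun q hq => ?_⟩⟩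
    · have : (0 : ℝ) ≤ ones s q.1 q.2 := by exact_mod_cast ones_nonneg s q.1 q.2
      have := hG q hq
      positivity
    · rw [div_lt_one (hG p hp)]
      have : (ones s p.1 p.2 : ℝ) ≤ p.2 := by exact_mod_cast ones_le s p.1 p.2
      linarith
    · rw [div_lt_div_iff₀ (hG p hp) (hG q hq)]
      have h : ((q.2 * (ones s p.1 p.2 - 1) : ℤ) : ℝ) < (p.2 * (ones s q.1 q.2 + 1) : ℤ) := by
        exact_mod_cast hs.mul_lt_mul p.1 q.1 (Finset.mem_filter.1 hq).2
      push_cast at h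
      linarith
  obtain ⟨a, ha, ha'⟩ := Order.exists_between_finsets lo hi hlohi
  -- A second point leaves an interval between the bounds, in which an irrational can be chosen.
  obtain ⟨b, hb, hb'⟩ := Order.exists_between_finsets {a} hi (by simpa using ha')
  obtain ⟨α, hα, haα, hαb⟩ := exists_irrational_btwn (hb a (by simp))
  refine ⟨α, hα, (ha 0 (by simp [lo])).trans haα, hαb.trans (hb' 1 (by simp [hi])), ?_⟩
  intro k n hkn
  rcases n.eq_zero_or_pos with rfl | hn
  · simp [ones_zero]
  have hmem : (k, n) ∈ G := Finset.mem_filter.2 ⟨hkn, hn⟩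
  have h1 := (ha _ (Finset.mem_insert_of_mem (Finset.mem_image_of_mem _ hmem))).trans haα
  have h2 := hαb.trans (hb' _ (Finset.mem_insert_of_mem (Finset.mem_image_of_mem _ hmem)))
  have hn' := hG _ hmem
  rw [div_lt_iff₀ hn'] at h1
  rw [lt_div_iff₀ hn'] at h2
  simp only at h1 h2
  rw [abs_lt]
  constructor <;> linarith

/-- The intercept is the largest deviation of a partial sum from the line of slope α. All deviations
lie within 1 of it because inner factors, not just prefixes, are close to the slope. -/
theorem exists_intercept {s : ℤ → Fin 2} {α : ℝ} {k : ℤ} {n : ℕ}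
    (h : ∀ i j, i + j ≤ n → |(ones s (k + i) j : ℝ) - j * α| < 1) :
    ∃ ρ, 0 ≤ ρ ∧ ρ < 1 ∧ ∀ i ≤ n, ones s k i = mechanical α ρ i := by
  obtain ⟨i₀, hi₀, hmax⟩ := (Finset.range (n + 1)).exists_max_image
    (fun i => (ones s k i : ℝ) - i * α) ⟨0, by simp⟩
  rw [Finset.mem_range, Nat.lt_succ_iff] at hi₀
  have hlt : ∀ j ≤ n, (ones s k i₀ : ℝ) - i₀ * α < ones s k j - j * α + 1 := by
    intro j hj
    rcases le_total i₀ j with hij | hij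
    · obtain ⟨d, rfl⟩ := Nat.exists_eq_add_of_le hij
      have := abs_lt.1 (h i₀ d hj)
      rw [ones_add]
      push_cast
      linarith [this.1]
    · obtain ⟨d, rfl⟩ := Nat.exists_eq_add_of_le hij
      have := abs_lt.1 (h j d hi₀)
      rw [ones_add]
      push_cast
      linarith [this.2]
  refine ⟨(ones s k i₀ : ℝ) - i₀ * α, ?_, ?_, fun i hi => ?_⟩
  · simpa [ones_zero] using hmax 0 (by simp)
  · simpa [ones_zero] using hlt 0 (Nat.zero_le n)
  · have h1 := hmax i (by simpa [Nat.lt_succ_iff] using hi)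
    have h2 := hlt i hi
    rw [eq_comm, mechanical, Int.floor_eq_iff]
    constructor <;> linarith

theorem IsBalanced.exists_mechanical {s : ℤ → Fin 2} (hs : IsBalanced s) {u v : List (Fin 2)}
    (hu : u ∈ language s) (hv : v ∈ language s) :
    ∃ α : ℝ, Irrational α ∧ 0 < α ∧ α < 1 ∧
      (∃ ρ n, 0 ≤ ρ ∧ ρ < 1 ∧ u = incrementWord (mechanical α ρ) n) ∧
      ∃ ρ n, 0 ≤ ρ ∧ ρ < 1 ∧ v = incrementWord (mechanical α ρ) n := by
  obtain ⟨k, m, rfl⟩ := exists_eq_incrementWord hu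
  obtain ⟨l, n, rfl⟩ := exists_eq_incrementWord hv
  obtain ⟨α, hα, h0, h1, h⟩ := hs.exists_slope
    ((Finset.Icc k (k + m) ×ˢ Finset.range (m + 1)) ∪ (Finset.Icc l (l + n) ×ˢ Finset.range (n + 1)))
  obtain ⟨ρ, hρ, hρ1, hρu⟩ := exists_intercept (s := s) (α := α) (k := k) (n := m)
    fun i j hij => h _ _ (by simp; omega)
  obtain ⟨σ, hσ, hσ1, hσv⟩ := exists_intercept (s := s) (α := α) (k := l) (n := n)
    fun i j hij => h _ _ (by simp; omega)
  exact ⟨α, hα, h0, h1, ⟨ρ, m, hρ, hρ1, incrementWord_congr hρu⟩,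
    ⟨σ, n, hσ, hσ1, incrementWord_congr hσv⟩⟩

end QMarkoff

/-- Both `μ_q(u)₁₂` and `μ_q(v)₁₂` are honest polynomials in `q`, and the first precedes the
second. -/
theorem mainTheorem1 (s : ℤ → Fin 2) (hs : QMarkoff.IsBalanced s) (u v : List (Fin 2))
    (hu : u ∈ QMarkoff.language s) (hv : v ∈ QMarkoff.language s)
    (huv : QMarkoff.RadixLT u v) :
    ∃ f g : Polynomial ℤ,
      Polynomial.toLaurent f = QMarkoff.muq12 u ∧
      Polynomial.toLaurent g = QMarkoff.muq12 v ∧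
      QMarkoff.PolyPrec f g := by
  obtain ⟨α, hα, h0, h1, ⟨ρ, m, hρ, hρ1, rfl⟩, ⟨σ, n, hσ, hσ1, rfl⟩⟩ :=
    hs.exists_mechanical hu hv
  exact ⟨_, _, QMarkoff.toLaurent_wordMatrix _, QMarkoff.toLaurent_wordMatrix _,
    QMarkoff.polyPrec_mechanical_of_radixLT hα h0 h1 hρ hρ1 hσ hσ1 huv⟩
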